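/- Let $\mathbb{F}$ be an algebraically closed field of characteristic $p \ge 0$, and let $A$ be a finite-dimensional associative (not necessarily unital) algebra over $\mathbb{F}$. For an integer $k \ge 1$, call $A$ $k$-perfect if it has no proper two-sided ideal of codimension at most $k$. Let $A^{(1)} = [A,A]$ be the linear span of all commutators $[x,y] = xy - yx$ with $x, y \in A$, regarded as a Lie algebra under the commutator bracket. Suppose that either $A$ is $4$-perfect, or $A$ is $1$-perfect and $p \ne 2$. Then the Lie algebra $A^{(1)}$ is perfect, that is, $[A^{(1)}, A^{(1)}] = A^{(1)}$, and $A = A^{(1)}A^{(1)} + A^{(1)}$, where $A^{(1)}A^{(1)}$ denotes the linear span of all products $xy$ with $x, y \in A^{(1)}$. -/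

import Mathlib

/-- The commutator Lie ring `⁅x, y⁆ = x * y - y * x` of a (not necessarily unital)
associative ring. -/
instance (priority := 100) commutatorLieRing {A : Type*} [NonUnitalRing A] : LieRing A where
  bracket x y := x * y - y * x
  add_lie x y z := by simp only [add_mul, mul_add]; abel
  lie_add x y z := by simp only [add_mul, mul_add]; abel
  lie_self x := sub_self _
  leibniz_lie x y z := by simp only [mul_sub, sub_mul, mul_assoc]; abel

/-- The commutator Lie algebra of a (not necessarily unital) associative algebra. -/
instance (priority := 100) commutatorLieAlgebra {F A : Type*} [CommRing F] [NonUnitalRing A]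
    [Module F A] [IsScalarTower F A A] [SMulCommClass F A A] : LieAlgebra F A where
  lie_smul t x y := by
    change x * (t • y) - (t • y) * x = t • (x * y - y * x)
    rw [mul_smul_comm, smul_mul_assoc, smul_sub]

/-- A subspace of an algebra that is a two-sided ideal. -/
def IsAlgIdeal {F A : Type*} [Field F] [NonUnitalRing A] [Module F A]
    (I : Submodule F A) : Prop :=
  ∀ a : A, ∀ x ∈ I, a * x ∈ I ∧ x * a ∈ I

/-- An associative algebra is `k`-perfect if it has no proper ideal of codimension at most `k`. -/
def IsKPerfect (F A : Type*) [Field F] [NonUnitalRing A] [Module F A] (k : ℕ) : Prop :=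
  ¬ ∃ I : Submodule F A, IsAlgIdeal I ∧ I ≠ ⊤ ∧ Module.rank F (A ⧸ I) ≤ (k : Cardinal)

/-- A Lie algebra `L` is perfect if `[L, L] = L`. -/
def IsPerfectLie (F L : Type*) [CommRing F] [LieRing L] [LieAlgebra F L] : Prop :=
  ⁅(⊤ : LieIdeal F L), (⊤ : LieIdeal F L)⁆ = ⊤

/-- The derived subalgebra `[A, A]` of the commutator Lie algebra of `A`, as a Lie ideal
(the linear span of all commutators). -/
def commutatorIdeal (F A : Type*) [Field F] [NonUnitalRing A] [Module F A]
    [IsScalarTower F A A] [SMulCommClass F A A] : LieIdeal F A :=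
  ⁅(⊤ : LieIdeal F A), (⊤ : LieIdeal F A)⁆

/-- The product `UW` of two subspaces of an algebra: the linear span of all `u * w`
with `u ∈ U` and `w ∈ W`. -/
def subspaceMul {F A : Type*} [Field F] [NonUnitalRing A] [Module F A]
    (U W : Submodule F A) : Submodule F A :=
  Submodule.span F {z | ∃ u ∈ U, ∃ w ∈ W, u * w = z}

/-! Put L = [A, A] and U = [L, L]. It suffices that UU + U = A: the identity [b, uv] = [vb, u] +
[bu, v] then gives [A, A] ⊆ U, so U = L and both claims follow. The largest ideal inside UU + U
contains [U, U] (`lie_mem_subspaceMulSupCore`). Were it proper, 1-perfectness and Burnside's theorem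
would give a surjection of A onto n × n matrices killing it (`IsKPerfect.exists_surjective_matrix`).
The hypotheses force n ≥ 2, and n ≥ 3 or p ≠ 2, so the matrix units off the diagonal survive in the
image of every iterated commutator (`ContainsSl.lie`), in particular of [U, U]: a contradiction. -/

/-- **Burnside's theorem**: an irreducible algebra of endomorphisms of a finite-dimensional space
over an algebraically closed field consists of all endomorphisms. -/
theorem Subalgebra.eq_top_of_irreducible {F V : Type*} [Field F] [IsAlgClosed F]
    [AddCommGroup V] [Module F V] [FiniteDimensional F V] [Nontrivial V]
    (S : Subalgebra F (Module.End F V))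
    (hS : ∀ X : Submodule F V, (∀ s ∈ S, ∀ x ∈ X, s x ∈ X) → X = ⊥ ∨ X = ⊤) : S = ⊤ := by
  have hsimple : IsSimpleModule S V := by
    refine (isSimpleModule_iff S V).2 ⟨fun X => ?_⟩
    rcases hS (X.restrictScalars F) fun s hs x hx => X.smul_mem (⟨s, hs⟩ : S) hx with h | h
    · left
      exact (Submodule.restrictScalars_eq_bot_iff _ _ _).1 h
    · right
      exact (Submodule.restrictScalars_eq_top_iff _ _ _).1 h
  have hschur := (IsSimpleModule.algebraMap_end_bijective_of_isAlgClosed (A := S) (V := V) F).2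
  refine eq_top_iff.2 fun f _ => ?_
  -- By Schur the `S`-endomorphisms of `V` are scalars, so `f` commutes with them and the density
  -- theorem applies.
  let g : Module.End (Module.End S V) V :=
    { toFun := f
      map_add' := f.map_add
      map_smul' := fun c x => by
        obtain ⟨t, rfl⟩ := hschur c
        simp }
  obtain ⟨s, hs⟩ := Module.Finite.fg_top (R := F) (M := V)
  obtain ⟨r, hr⟩ := jacobson_density g s
  have : f = r := by
    refine LinearMap.ext_on hs fun x hx => ?_
    exact hr x hx
  rw [this]
  exact r.2

/-- A nonzero irreducible representation of a not necessarily unital algebra on a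
finite-dimensional space over an algebraically closed field is surjective. -/
theorem NonUnitalAlgHom.surjective_of_irreducible {F A V : Type*} [Field F] [IsAlgClosed F]
    [NonUnitalRing A] [Module F A] [IsScalarTower F A A] [SMulCommClass F A A]
    [AddCommGroup V] [Module F V] [FiniteDimensional F V] [Nontrivial V]
    (φ : A →ₙₐ[F] Module.End F V) (hφ : ∃ a, φ a ≠ 0)
    (hirr : ∀ X : Submodule F V, (∀ a, ∀ x ∈ X, φ a x ∈ X) → X = ⊥ ∨ X = ⊤) :
    Function.Surjective φ := by
  have htop : (Unitization.lift φ).range = ⊤ := by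
    refine Subalgebra.eq_top_of_irreducible _ fun X hX => hirr X fun a x hx => hX _ ?_ x hx
    exact ⟨(a : Unitization F A), by simp⟩
  have hex (f : Module.End F V) : ∃ (t : F) (b : A), f = t • 1 + φ b := by
    obtain ⟨u, rfl⟩ : f ∈ (Unitization.lift φ).range := htop ▸ Algebra.mem_top
    exact ⟨u.fst, u.snd, by simp [Unitization.lift, Algebra.algebraMap_eq_smul_one]⟩
  obtain ⟨a, ha⟩ := hφ
  -- Since `End V` is the image of `φ` plus scalars, this image is an ideal of a simple ring.
  let J : TwoSidedIdeal (Module.End F V) := TwoSidedIdeal.mk' (Set.range φ) ⟨0, map_zero φ⟩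
    (by rintro _ _ ⟨x, rfl⟩ ⟨y, rfl⟩; exact ⟨x + y, map_add φ x y⟩)
    (by rintro _ ⟨x, rfl⟩; exact ⟨-x, map_neg φ x⟩)
    (by
      rintro f _ ⟨y, rfl⟩
      obtain ⟨t, b, rfl⟩ := hex f
      exact ⟨t • y + b * y, by simp [add_mul]⟩)
    (by
      rintro _ f ⟨y, rfl⟩
      obtain ⟨t, b, rfl⟩ := hex f
      exact ⟨t • y + y * b, by simp [mul_add]⟩)
  have hJ (f : Module.End F V) : f ∈ J ↔ f ∈ Set.range φ := TwoSidedIdeal.mem_mk' ..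
  have : Nonempty (Fin (Module.finrank F V)) := ⟨⟨0, Module.finrank_pos⟩⟩
  have : IsSimpleRing (Module.End F V) :=
    .of_ringEquiv (LinearMap.toMatrixAlgEquiv (Module.finBasis F V)).symm.toRingEquiv inferInstance
  intro f
  rcases eq_bot_or_eq_top J with h | h
  · exact absurd ((TwoSidedIdeal.mem_bot _).1 (h ▸ (hJ _).2 ⟨a, rfl⟩)) ha
  · exact (hJ f).1 (h ▸ trivial)

/-! ### Perfectness and matrix quotients -/

section KPerfect

variable {F A : Type*} [Field F] [NonUnitalRing A] [Module F A]

theorem IsKPerfect.mono {k l : ℕ} (hkl : k ≤ l) (h : IsKPerfect F A l) : IsKPerfect F A k :=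
  fun ⟨I, hI, hne, hr⟩ => h ⟨I, hI, hne, hr.trans (by exact_mod_cast hkl)⟩

/-- A `1`-perfect algebra is spanned by products. -/
theorem IsKPerfect.eq_top_of_mul_mem (h : IsKPerfect F A 1) (W : Submodule F A)
    (hW : ∀ a b : A, a * b ∈ W) : W = ⊤ := by
  by_contra hne
  -- A hyperplane containing all products is an ideal of codimension 1.
  obtain ⟨f, hf, hWf⟩ := Submodule.exists_le_ker_of_lt_top W (lt_top_iff_ne_top.2 hne)
  refine h ⟨f.ker, fun a x _ => ⟨hWf (hW _ _), hWf (hW _ _)⟩, ?_, ?_⟩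
  · rwa [Ne, LinearMap.ker_eq_top]
  · have := LinearMap.lift_rank_le_of_injective (f.quotKerEquivRange.toLinearMap)
      f.quotKerEquivRange.injective
    have h2 := Submodule.rank_le f.range
    rw [Module.rank_self] at h2
    have h3 := this.trans (Cardinal.lift_le.2 h2)
    simpa using h3

/-- The kernel of `ψ` is a proper ideal of codimension n². -/
theorem IsKPerfect.lt_sq_of_surjective [FiniteDimensional F A] {k n : ℕ} (h : IsKPerfect F A k)
    (hn : 0 < n) (ψ : A →ₙₐ[F] Matrix (Fin n) (Fin n) F) (hψ : Function.Surjective ψ) :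
    k < n * n := by
  by_contra! hle
  let f : A →ₗ[F] Matrix (Fin n) (Fin n) F := (ψ : A →ₗ[F] Matrix (Fin n) (Fin n) F)
  have hf (a : A) : f a = ψ a := rfl
  have : Nonempty (Fin n) := ⟨⟨0, hn⟩⟩
  refine h ⟨f.ker, fun a x hx => ?_, fun htop => ?_, ?_⟩
  · rw [LinearMap.mem_ker, hf] at hx
    simp [hf, hx]
  · obtain ⟨a, ha⟩ := hψ 1
    have : f a = 0 := LinearMap.mem_ker.1 (htop ▸ Submodule.mem_top)
    exact one_ne_zero (ha.symm.trans this)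
  · have hfin := (f.quotKerEquivOfSurjective hψ).finrank_eq
    rw [Module.finrank_matrix, Fintype.card_fin, Module.finrank_self, mul_one] at hfin
    rw [← Module.finrank_eq_rank, hfin]
    exact_mod_cast hle

variable [IsScalarTower F A A] [SMulCommClass F A A]

/-- A proper ideal of a finite-dimensional `1`-perfect algebra is contained in the kernel of a
surjection onto a matrix algebra. -/
theorem IsKPerfect.exists_surjective_matrix [IsAlgClosed F] [FiniteDimensional F A]
    (h : IsKPerfect F A 1) (I : Submodule F A) (hI : IsAlgIdeal I) (hne : I ≠ ⊤) :
    ∃ (n : ℕ) (ψ : A →ₙₐ[F] Matrix (Fin n) (Fin n) F), 0 < n ∧ Function.Surjective ψ ∧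
      ∀ x ∈ I, ψ x = 0 := by
  -- `W` is a maximal left ideal containing `I`, so `A ⧸ W` has no proper nonzero submodule; `I`
  -- kills it, being also a right ideal.
  obtain ⟨W, ⟨hWleft, hIW, hWne⟩, hmax⟩ := (wellFounded_gt (α := Submodule F A)).has_min
    {W | (∀ a, ∀ x ∈ W, a * x ∈ W) ∧ I ≤ W ∧ W ≠ ⊤} ⟨I, fun a x hx => (hI a x hx).1, le_rfl, hne⟩
  let φ : A →ₙₐ[F] Module.End F (A ⧸ W) :=
    { toFun := fun a => W.mapQ W (LinearMap.mulLeft F a) fun x hx => hWleft a x hx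
      map_smul' := fun t a => by
        ext x; exact congrArg Submodule.Quotient.mk (smul_mul_assoc t a x)
      map_zero' := by ext x; simp
      map_add' := fun a b => by ext x; exact congrArg Submodule.Quotient.mk (add_mul a b x)
      map_mul' := fun a b => by ext x; exact congrArg Submodule.Quotient.mk (mul_assoc a b x) }
  have hφ (a x : A) : φ a (Submodule.Quotient.mk x) = Submodule.Quotient.mk (a * x) := rfl
  have : Nontrivial (A ⧸ W) := Submodule.Quotient.nontrivial_iff.2 hWne
  have hsurj : Function.Surjective φ := by
    refine φ.surjective_of_irreducible ?_ fun X hX => ?_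
    · by_contra! h0
      refine hWne (h.eq_top_of_mul_mem W fun a b => ?_)
      rw [← Submodule.Quotient.mk_eq_zero, ← hφ, h0, LinearMap.zero_apply]
    · have hWX : W ≤ X.comap W.mkQ := by
        simpa using Submodule.comap_mono (f := W.mkQ) (bot_le : ⊥ ≤ X)
      have hXmap : (X.comap W.mkQ).map W.mkQ = X :=
        Submodule.map_comap_eq_of_surjective W.mkQ_surjective X
      by_cases htop : X.comap W.mkQ = ⊤
      · right
        rw [← hXmap, htop, Submodule.map_top, Submodule.range_mkQ]
      · left
        have : W = X.comap W.mkQ := hWX.eq_of_not_lt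
          (hmax _ ⟨fun a x hx => hX a _ hx, hIW.trans hWX, htop⟩)
        rw [← hXmap, ← this, Submodule.mkQ_map_self]
  let e := LinearMap.toMatrixAlgEquiv (Module.finBasis F (A ⧸ W))
  let ρ := e.toAlgHom.toNonUnitalAlgHom
  refine ⟨_, ρ.comp φ, Module.finrank_pos, e.surjective.comp hsurj, ?_⟩
  intro x hx
  have : φ x = 0 := by
    ext y
    change (Submodule.Quotient.mk (x * y) : A ⧸ W) = 0
    exact (Submodule.Quotient.mk_eq_zero W).2 (hIW (hI y x hx).2)
  change e (φ x) = 0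
  rw [this, map_zero]

end KPerfect

/-! ### Commutators of matrix units -/

section Matrix

variable {F A : Type*} [Field F] [NonUnitalRing A] [Module F A]

theorem map_commutator {n : ℕ} (ψ : A →ₙₐ[F] Matrix (Fin n) (Fin n) F) (x y : A) :
    ψ ⁅x, y⁆ = ψ x * ψ y - ψ y * ψ x := by
  change ψ (x * y - y * x) = _
  rw [map_sub, map_mul, map_mul]

variable [IsScalarTower F A A] [SMulCommClass F A A]

/-- The image of a Lie ideal under `ψ` contains the standard spanning set of `𝔰𝔩ₙ`. -/
def ContainsSl {n : ℕ} (ψ : A →ₙₐ[F] Matrix (Fin n) (Fin n) F) (U : LieIdeal F A) : Prop :=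
  ∀ i j, i ≠ j → (∃ u ∈ U, ψ u = Matrix.single i j 1) ∧
    ∃ u ∈ U, ψ u = Matrix.single i i 1 - Matrix.single j j 1

/-- Either e_ij = [e_ik, e_kj] for a third index k, or 2 e_ij = [e_ii - e_jj, e_ij] with 2
invertible; and e_ii - e_jj = [e_ij, e_ji]. -/
theorem ContainsSl.lie {n : ℕ} {ψ : A →ₙₐ[F] Matrix (Fin n) (Fin n) F} {U : LieIdeal F A}
    (hn : 3 ≤ n ∨ (2 : F) ≠ 0) (h : ContainsSl ψ U) : ContainsSl ψ ⁅U, U⁆ := by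
  intro i j hij
  obtain ⟨⟨u, hu, hue⟩, w, hw, hwe⟩ := h i j hij
  obtain ⟨⟨v, hv, hve⟩, -⟩ := h j i hij.symm
  refine ⟨?_, ⁅u, v⁆, LieSubmodule.lie_mem_lie hu hv, ?_⟩
  · rcases hn with hn | h2
    · obtain ⟨k, hk⟩ : ∃ k : Fin n, k ∉ ({i, j} : Finset (Fin n)) := by
        by_contra! hall
        have := Finset.card_le_card (fun k _ => hall k : Finset.univ ⊆ ({i, j} : Finset (Fin n)))
        have := Finset.card_le_two (a := i) (b := j)
        rw [Finset.card_univ, Fintype.card_fin] at *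
        omega
      simp only [Finset.mem_insert, Finset.mem_singleton, not_or] at hk
      obtain ⟨⟨a, ha, hae⟩, -⟩ := h i k (Ne.symm hk.1)
      obtain ⟨⟨b, hb, hbe⟩, -⟩ := h k j hk.2
      refine ⟨⁅a, b⁆, LieSubmodule.lie_mem_lie ha hb, ?_⟩
      rw [map_commutator, hae, hbe, Matrix.single_mul_single_same,
        Matrix.single_mul_single_of_ne _ _ _ _ hij.symm, mul_one, sub_zero]
    · refine ⟨(2 : F)⁻¹ • ⁅w, u⁆, Submodule.smul_mem _ _ (LieSubmodule.lie_mem_lie hw hu), ?_⟩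
      rw [map_smul, map_commutator, hwe, hue, sub_mul, mul_sub, Matrix.single_mul_single_same,
        Matrix.single_mul_single_same, Matrix.single_mul_single_of_ne _ _ _ _ hij.symm,
        Matrix.single_mul_single_of_ne _ _ _ _ hij.symm, mul_one, sub_zero, zero_sub, sub_neg_eq_add,
        ← two_smul F, smul_smul, inv_mul_cancel₀ h2, one_smul]
  · rw [map_commutator, hue, hve, Matrix.single_mul_single_same, Matrix.single_mul_single_same,
      mul_one]

theorem containsSl_top {n : ℕ} {ψ : A →ₙₐ[F] Matrix (Fin n) (Fin n) F}
    (hψ : Function.Surjective ψ) : ContainsSl ψ ⊤ := fun _ _ _ =>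
  ⟨(hψ _).imp fun _ h => ⟨LieSubmodule.mem_top _, h⟩,
    (hψ _).imp fun _ h => ⟨LieSubmodule.mem_top _, h⟩⟩

end Matrix

/-! ### Lie ideals and the associative ideals they generate -/

section Herstein

variable {F A : Type*} [Field F] [NonUnitalRing A] [Module F A] [IsScalarTower F A A]
  [SMulCommClass F A A]

theorem commutator_mem (U : LieIdeal F A) {u : A} (hu : u ∈ U) (a : A) :
    a * u - u * a ∈ U := lie_mem_right F A U a u hu

/-- The subspace `UU + U`. -/
def subspaceMulSup (U : LieIdeal F A) : Submodule F A :=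
  subspaceMul U.toSubmodule U.toSubmodule ⊔ U.toSubmodule

theorem mem_subspaceMulSup {U : LieIdeal F A} {u : A} (hu : u ∈ U) : u ∈ subspaceMulSup U :=
  Submodule.mem_sup_right hu

theorem mul_mem_subspaceMulSup {U : LieIdeal F A} {u v : A} (hu : u ∈ U) (hv : v ∈ U) :
    u * v ∈ subspaceMulSup U :=
  Submodule.mem_sup_left (Submodule.subset_span ⟨u, hu, v, hv, rfl⟩)

theorem subspaceMulSup_le {U : LieIdeal F A} {X : Submodule F A}
    (hmul : ∀ u ∈ U, ∀ v ∈ U, u * v ∈ X) (hX : ∀ u ∈ U, u ∈ X) : subspaceMulSup U ≤ X := by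
  refine sup_le (Submodule.span_le.2 ?_) hX
  rintro _ ⟨u, hu, v, hv, rfl⟩
  exact hmul u hu v hv

/-- The map [a, ·] is a derivation preserving `U`, hence also `UU`. -/
theorem commutator_mem_subspaceMulSup {U : LieIdeal F A} {x : A} (hx : x ∈ subspaceMulSup U)
    (a : A) : a * x - x * a ∈ subspaceMulSup U := by
  have hle : subspaceMulSup U ≤
      (subspaceMulSup U).comap (LinearMap.mulLeft F a - LinearMap.mulRight F a) := by
    refine subspaceMulSup_le (fun u hu v hv => ?_) fun u hu =>
      mem_subspaceMulSup (commutator_mem U hu a)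
    have : a * (u * v) - u * v * a = (a * u - u * a) * v + u * (a * v - v * a) := by
      noncomm_ring
    change a * (u * v) - u * v * a ∈ subspaceMulSup U
    rw [this]
    exact add_mem (mul_mem_subspaceMulSup (commutator_mem U hu a) hv)
      (mul_mem_subspaceMulSup hu (commutator_mem U hv a))
  exact hle hx

/-- The largest ideal contained in `UU + U`, for a Lie ideal `U`. -/
def subspaceMulSupCore (U : LieIdeal F A) : Submodule F A where
  carrier := {x | x ∈ subspaceMulSup U ∧ ∀ a, x * a ∈ subspaceMulSup U}
  add_mem' hx hy := ⟨add_mem hx.1 hy.1, fun a => by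
    rw [add_mul]; exact add_mem (hx.2 a) (hy.2 a)⟩
  zero_mem' := ⟨zero_mem _, fun a => by rw [zero_mul]; exact zero_mem _⟩
  smul_mem' t x hx := ⟨Submodule.smul_mem _ t hx.1, fun a => by
    rw [smul_mul_assoc]; exact Submodule.smul_mem _ t (hx.2 a)⟩

/-- Controlling right multiples is enough: ax = [a, x] + xa, and `UU + U` is stable under
commutators. -/
theorem isAlgIdeal_subspaceMulSupCore (U : LieIdeal F A) : IsAlgIdeal (subspaceMulSupCore U) := by
  have hleft : ∀ {x : A} (_ : x ∈ subspaceMulSup U) (a : A) (_ : x * a ∈ subspaceMulSup U),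
      a * x ∈ subspaceMulSup U := by
    intro x hx a hxa
    simpa using add_mem (commutator_mem_subspaceMulSup hx a) hxa
  refine fun a x hx => ⟨⟨hleft hx.1 a (hx.2 a), fun b => ?_⟩, hx.2 a, fun b => ?_⟩
  · rw [mul_assoc]
    exact hleft (hx.2 b) a (by rw [mul_assoc]; exact hx.2 _)
  · rw [mul_assoc]
    exact hx.2 _

/-- Rests on [u, v]a = [u, va] + v[a, u], which lies in `U + UU`. -/
theorem lie_mem_subspaceMulSupCore {U : LieIdeal F A} {x : A} (hx : x ∈ ⁅U, U⁆) :
    x ∈ subspaceMulSupCore U := by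
  suffices (⁅U, U⁆ : LieIdeal F A).toSubmodule ≤ subspaceMulSupCore U from this hx
  rw [LieSubmodule.lieIdeal_oper_eq_linear_span', Submodule.span_le]
  rintro _ ⟨u, hu, v, hv, rfl⟩
  refine ⟨mem_subspaceMulSup (lie_mem_right F A U u v hv), fun a => ?_⟩
  have : ⁅u, v⁆ * a = -((v * a) * u - u * (v * a)) + v * (a * u - u * a) := by
    change (u * v - v * u) * a = _
    noncomm_ring
  rw [this]
  exact add_mem (neg_mem (mem_subspaceMulSup (commutator_mem U hu _)))
    (mul_mem_subspaceMulSup hv (commutator_mem U hu a))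

/-- If `A = UU + U` for a Lie ideal `U`, then `[A, A] ⊆ U`. -/
theorem commutatorIdeal_le_of_subspaceMulSup_eq_top {U : LieIdeal F A}
    (h : subspaceMulSup U = ⊤) : commutatorIdeal F A ≤ U := by
  refine (LieSubmodule.lie_le_iff _ _ _).2 fun b _ a _ => ?_
  have hle : subspaceMulSup U ≤
      U.toSubmodule.comap (LinearMap.mulLeft F b - LinearMap.mulRight F b) := by
    refine subspaceMulSup_le (fun u hu v hv => ?_) fun u hu => commutator_mem U hu b
    have : b * (u * v) - u * v * b = (v * b * u - u * (v * b)) + (b * u * v - v * (b * u)) := by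
      noncomm_ring
    change b * (u * v) - u * v * b ∈ U
    rw [this]
    exact add_mem (commutator_mem U hu _) (commutator_mem U hv _)
  exact hle (h ▸ Submodule.mem_top)

end Herstein

theorem theorem1p2 {F A : Type*} [Field F] [IsAlgClosed F] (p : ℕ) [CharP F p]
    [NonUnitalRing A] [Module F A] [IsScalarTower F A A] [SMulCommClass F A A]
    [FiniteDimensional F A]
    (h : IsKPerfect F A 4 ∨ (IsKPerfect F A 1 ∧ p ≠ 2)) :
    IsPerfectLie F (commutatorIdeal F A) ∧
      subspaceMul (commutatorIdeal F A).toSubmodule (commutatorIdeal F A).toSubmodule ⊔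
        (commutatorIdeal F A).toSubmodule = ⊤ := by
  have h1 : IsKPerfect F A 1 := h.elim (IsKPerfect.mono (by norm_num)) And.left
  set L := commutatorIdeal F A
  have htop : subspaceMulSup (⁅L, L⁆ : LieIdeal F A) = ⊤ := by
    suffices subspaceMulSupCore (⁅L, L⁆ : LieIdeal F A) = ⊤ from
      eq_top_iff.2 fun x _ => (this ▸ Submodule.mem_top : x ∈ subspaceMulSupCore ⁅L, L⁆).1
    by_contra hne
    obtain ⟨n, ψ, hn0, hψ, hker⟩ :=
      h1.exists_surjective_matrix _ (isAlgIdeal_subspaceMulSupCore _) hne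
    have hn1 : 1 < n := by
      have := h1.lt_sq_of_surjective hn0 ψ hψ
      nlinarith
    have hn : 3 ≤ n ∨ (2 : F) ≠ 0 := by
      rcases h with h4 | ⟨-, hp⟩
      · have := h4.lt_sq_of_surjective hn0 ψ hψ
        left
        nlinarith
      · right
        intro h2
        rcases (Nat.dvd_prime Nat.prime_two).1 ((CharP.cast_eq_zero_iff F p 2).1
          (by exact_mod_cast h2)) with rfl | rfl
        · exact CharP.char_ne_one F 1 rfl
        · exact hp rfl
    -- Three brackets lead from `A` through `L` and `⁅L, L⁆` to `⁅⁅L, L⁆, ⁅L, L⁆⁆`, which `ψ` kills.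
    have hsl := (((containsSl_top hψ).lie hn).lie hn).lie hn
    obtain ⟨⟨x, hx, hxe⟩, -⟩ := hsl ⟨0, hn0⟩ ⟨1, hn1⟩ (by simp)
    rw [hker x (lie_mem_subspaceMulSupCore hx)] at hxe
    simpa using congrFun₂ hxe ⟨0, hn0⟩ ⟨1, hn1⟩
  have hle : ⁅L, L⁆ ≤ L := LieSubmodule.lie_le_right _ _
  have hperf : ⁅L, L⁆ = L := hle.antisymm (commutatorIdeal_le_of_subspaceMulSup_eq_top htop)
  refine ⟨?_, by rwa [hperf] at htop⟩
  have hcomap : LieIdeal.comap L.incl L = ⊤ := by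
    ext x
    simp
  have := LieIdeal.comap_bracket_incl_of_le L le_rfl le_rfl
  rwa [hperf, hcomap] at this
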